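/- For a field $K$, let $K((T^{-1}))$ be the field of formal Laurent series $\sum_{n\ge -n_0} a_nT^{-n}$ with coefficients in $K$, which contains the field $K(T)$ of rational functions, and let $$\Pi_2=\prod_{j=1}^{\infty}\left(1-\frac{1}{T^{2^j-1}}\right)^{-1}\in \mathbb{F}_2((T^{-1})),$$ an infinite product that converges in the $T^{-1}$-adic topology. For $n\ge 0$ let $p_n^{(2)}=1$ if $n=0$ or if there is a finite set $J$ of positive integers such that $n=\sum_{j\in J}(2^j-1)$, and let $p_n^{(2)}=0$ otherwise. (1) $\Pi_2$ is transcendental over $\mathbb{F}_2(T)$. (2) More generally, for every finite field $K$ (of any characteristic), the formal series $f(T)=\sum_{n\ge 0}p_n^{(2)}T^{-n}$ with coefficients in $K$ is transcendental over $K(T)$. -/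

import Mathlib

noncomputable section

/-- The field `K((T⁻¹))` of formal Laurent series in `T⁻¹`, that is, of the series
`∑_{n ≥ -n₀} aₙ T⁻ⁿ`. The underlying type is that of Laurent series in one variable, the variable
being read as `T⁻¹`: the coefficient of index `n` is the coefficient of `T⁻ⁿ`. It is a type synonym
because it carries a different structure of algebra over the field `K(T)`, for which the
indeterminate `T` is the inverse of the variable. -/
def LaurentSeriesAtInfty (K : Type*) [Field K] : Type _ := LaurentSeries K

namespace LaurentSeriesAtInfty

variable (K : Type*) [Field K]

instance : Field (LaurentSeriesAtInfty K) := inferInstanceAs (Field (LaurentSeries K))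

/-- The embedding of the coefficients `K` in `K((T⁻¹))` as the constants. -/
def C : K →+* LaurentSeriesAtInfty K := (HahnSeries.C : K →+* LaurentSeries K)

/-- The `T⁻¹`-adic valuation on `K((T⁻¹))`, with the topology that it defines. -/
instance : Valued (LaurentSeriesAtInfty K) (WithZero (Multiplicative ℤ)) :=
  inferInstanceAs (Valued (LaurentSeries K) (WithZero (Multiplicative ℤ)))

/-- The element `T` of `K((T⁻¹))`. -/
def T : LaurentSeriesAtInfty K := (HahnSeries.single (-1 : ℤ) (1 : K) : LaurentSeries K)

/-- The formal series `∑_{n ≥ 0} a n * T⁻ⁿ`. -/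
def mk {K : Type*} [Field K] (a : ℕ → K) : LaurentSeriesAtInfty K :=
  (HahnSeries.ofPowerSeries ℤ K (PowerSeries.mk a) : LaurentSeries K)

/-- The substitution of `T` in a polynomial. -/
def ofPolynomial : Polynomial K →+* LaurentSeriesAtInfty K :=
  Polynomial.eval₂RingHom (C K) (T K)

theorem ofPolynomial_injective : Function.Injective (ofPolynomial K) := by
  have key : ∀ (p : Polynomial K) (n : ℕ),
      HahnSeries.coeff (Polynomial.eval₂RingHom (HahnSeries.C : K →+* LaurentSeries K)
        (HahnSeries.single (-1 : ℤ) (1 : K)) p) (-(n : ℤ)) = p.coeff n := by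
    intro p n
    induction p using Polynomial.induction_on' with
    | add p q hp hq => rw [map_add, HahnSeries.coeff_add, hp, hq, Polynomial.coeff_add]
    | monomial k a =>
      rw [Polynomial.coe_eval₂RingHom, Polynomial.eval₂_monomial, HahnSeries.single_pow,
        HahnSeries.C_mul_eq_smul, HahnSeries.coeff_smul, HahnSeries.coeff_single,
        Polynomial.coeff_monomial]
      by_cases h : k = n
      · simp [h]
      · rw [if_neg h, if_neg (by simp; omega), smul_zero]
  intro p q hpq
  ext n
  rw [← key p n, ← key q n]
  exact congrArg (fun z : LaurentSeries K => HahnSeries.coeff z (-(n : ℤ))) hpq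

/-- The embedding of the field `K(T)` of rational functions into `K((T⁻¹))` that is the identity on
`K` and sends the indeterminate to `T`. -/
def ofRatFunc : RatFunc K →+* LaurentSeriesAtInfty K :=
  IsFractionRing.lift (A := Polynomial K) (ofPolynomial_injective K)

instance : Algebra (RatFunc K) (LaurentSeriesAtInfty K) := (ofRatFunc K).toAlgebra

theorem algebraMap_X : algebraMap (RatFunc K) (LaurentSeriesAtInfty K) RatFunc.X = T K := by
  change ofRatFunc K RatFunc.X = T K
  rw [← RatFunc.algebraMap_X, ofRatFunc, IsFractionRing.lift_algebraMap]
  simp [ofPolynomial]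

theorem algebraMap_C (a : K) : algebraMap (RatFunc K) (LaurentSeriesAtInfty K) (RatFunc.C a)
    = C K a := by
  change ofRatFunc K (RatFunc.C a) = _
  rw [← RatFunc.algebraMap_C, ofRatFunc, IsFractionRing.lift_algebraMap]
  simp [ofPolynomial]

end LaurentSeriesAtInfty

/-- For a finite field `F` with `q` elements, the factor
`(1 - 1 / T ^ (q ^ j - 1))⁻¹` of the infinite product `Π_q`. -/
def carlitzPiFactor (F : Type*) [Field F] (j : ℕ) : LaurentSeriesAtInfty F :=
  (1 - 1 / LaurentSeriesAtInfty.T F ^ (Nat.card F ^ j - 1))⁻¹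

/-- For a finite field `F` with `q` elements, Carlitz's analogue of `π`,
`Π_q = ∏_{j ≥ 1} (1 - 1 / T ^ (q ^ j - 1))⁻¹`, an infinite product in `F((T⁻¹))`. -/
def carlitzPi (F : Type*) [Field F] : LaurentSeriesAtInfty F :=
  ∏' j : ℕ, carlitzPiFactor F (j + 1)

open Classical in
/-- The sequence `p_n^{(2)}` with values in `{0, 1}`, read in `K`: it is `1` if `n = 0` or if there
is a set `J` of positive integers with `n = ∑_{j ∈ J} (2 ^ j - 1)`, and `0` otherwise. -/
def carlitzSeq (K : Type*) [Field K] (n : ℕ) : K :=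
  if n = 0 ∨ ∃ J : Finset ℕ, (∀ j ∈ J, 1 ≤ j) ∧ n = ∑ j ∈ J, (2 ^ j - 1) then 1 else 0

end

/-!
Write `X = T⁻¹`, `q = |K|` and `f = ∑ p_n X ^ n`. If `f` is algebraic, its powers `f ^ (q ^ i)`
satisfy a linear relation with coefficients in `K[X]`, and Cartier operators
`∑ aₙ Xⁿ ↦ ∑ a_{q n + r} Xⁿ` bring it to a form in which the coefficient `A` of `f` is not zero.
Then `f` lies in a finite set of series stable under all Cartier operators, namely a set of
combinations of the `(f / A) ^ (q ^ i)` with polynomial coefficients of bounded degree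
(`PowerSeries.exists_finite_cartier_stable`). Consequently, the number of different blocks
`p_{q ^ k n}, …, p_{q ^ k (n + 1) - 1}`, where `n` varies, is bounded independently of `k`.

The sequence `p_n` is the indicator of the set of the numbers `2 m - s(m)`, where `s(m)` is the
number of binary digits `1` of `m` (`mersenneSum m` below). The gap between the values at `m - 1`
and `m` is `1 + v₂(m)`, so runs of `R` zeros followed by a one end exactly at the values
at multiples of `2 ^ R`, which are at distance at least `2 ^ R`. If `Q = q ^ k ≤ 2 ^ R`, a block of
length `Q` therefore contains at most one such run, and blocks that contain it at different offsets
are different (`offset_eq_of_block_eq`). Many offsets occur: for `q` a power of `2`, the value at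
`2 ^ R (2 ^ c - 1)` is `-c` modulo `Q`; for `q` odd, the values `2 ^ (N + 1) - 1` at the powers
`2 ^ N` take the residues `2 ^ b - 1` modulo `Q` for all `b`. With `R = q k` and `k` large this
gives more blocks than the bound allows (`not_block_determined`).

For `K = 𝔽₂`, the inverse of `Π₂` is `∏ (1 + X ^ (2 ^ j - 1))`, and this is `f`, because a number
is a sum of distinct `2 ^ j - 1` in at most one way.
-/

/-! ### Sums of distinct numbers `2 ^ j - 1` -/

/-- The `n`-th element (from `n = 0` on) of the set of sums of distinct numbers `2 ^ j - 1` with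
`j ≥ 1`: a binary digit `1` of `n` of index `i` contributes `2 ^ (i + 1) - 1`. In other words, this
is `2 * n` minus the number of binary digits `1` of `n`. -/
def mersenneSum (n : ℕ) : ℕ := (n.bitIndices.map fun i => 2 ^ (i + 1) - 1).sum

@[simp] theorem mersenneSum_zero : mersenneSum 0 = 0 := by simp [mersenneSum]

theorem mersenneSum_two_mul (n : ℕ) : mersenneSum (2 * n) = 2 * n + mersenneSum n := by
  have h : ∀ l : List ℕ, (l.map fun i => 2 ^ (i + 1 + 1) - 1).sum
      = 2 * (l.map fun i => 2 ^ i).sum + (l.map fun i => 2 ^ (i + 1) - 1).sum := by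
    intro l
    induction l with
    | nil => simp
    | cons i l ih =>
      have h0 : 1 ≤ 2 ^ i := Nat.one_le_two_pow
      have h1 : 2 ^ (i + 1) = 2 * 2 ^ i := pow_succ' 2 i
      have h2 : 2 ^ (i + 1 + 1) = 2 * 2 ^ (i + 1) := pow_succ' 2 (i + 1)
      simp only [List.map_cons, List.sum_cons, ih]
      omega
  have := h n.bitIndices
  rw [Nat.sum_map_two_pow_bitIndices] at this
  simpa [mersenneSum, Function.comp_def] using this

theorem mersenneSum_two_mul_add_one (n : ℕ) :
    mersenneSum (2 * n + 1) = 2 * n + mersenneSum n + 1 := by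
  rw [← mersenneSum_two_mul, mersenneSum, mersenneSum, Nat.bitIndices_two_mul_add_one,
    Nat.bitIndices_two_mul]
  simp [add_comm]

theorem mersenneSum_lt_succ (n : ℕ) : mersenneSum n < mersenneSum (n + 1) := by
  induction n using Nat.strong_induction_on with
  | _ n ih =>
    obtain ⟨m, rfl | rfl⟩ := n.even_or_odd'
    · rw [mersenneSum_two_mul_add_one, mersenneSum_two_mul]
      omega
    · have := ih m (by omega)
      rw [show 2 * m + 1 + 1 = 2 * (m + 1) by ring, mersenneSum_two_mul_add_one,
        mersenneSum_two_mul]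
      omega

theorem mersenneSum_strictMono : StrictMono mersenneSum :=
  strictMono_nat_of_lt_succ mersenneSum_lt_succ

/-- The gap between consecutive values of `mersenneSum` is one more than the `2`-adic valuation of
the index of the second one. -/
theorem mersenneSum_add_lt_succ_iff {R m : ℕ} :
    mersenneSum m + R < mersenneSum (m + 1) ↔ 2 ^ R ∣ m + 1 := by
  induction R generalizing m with
  | zero => simpa using mersenneSum_lt_succ m
  | succ R ih =>
    obtain ⟨l, rfl | rfl⟩ := m.even_or_odd'
    · rw [mersenneSum_two_mul_add_one, mersenneSum_two_mul]
      refine ⟨fun h => by omega, fun h => ?_⟩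
      have : 2 ∣ 2 * l + 1 := (dvd_pow_self 2 R.succ_ne_zero).trans h
      omega
    · rw [show 2 * l + 1 + 1 = 2 * (l + 1) by ring, mersenneSum_two_mul_add_one,
        mersenneSum_two_mul, pow_succ', Nat.mul_dvd_mul_iff_left two_pos, ← ih]
      omega

theorem mersenneSum_two_pow_mul {m s : ℕ} (h : mersenneSum m + s = 2 * m) (R : ℕ) :
    mersenneSum (2 ^ R * m) + s = 2 * (2 ^ R * m) := by
  induction R with
  | zero => simpa using h
  | succ R ih =>
    rw [pow_succ', mul_assoc, mersenneSum_two_mul]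
    omega

theorem mersenneSum_two_pow_sub_one (c : ℕ) :
    mersenneSum (2 ^ c - 1) + c = 2 * (2 ^ c - 1) := by
  induction c with
  | zero => simp
  | succ c ih =>
    have : 1 ≤ 2 ^ c := Nat.one_le_two_pow
    rw [show 2 ^ (c + 1) - 1 = 2 * (2 ^ c - 1) + 1 by rw [pow_succ]; omega,
      mersenneSum_two_mul_add_one]
    omega

theorem mersenneSum_sum_two_pow (t : Finset ℕ) :
    mersenneSum (∑ i ∈ t, 2 ^ i) = ∑ i ∈ t, (2 ^ (i + 1) - 1) := by
  rw [mersenneSum, ← List.sum_toFinset _ Nat.bitIndices_nodup,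
    Finset.toFinset_bitIndices_sum_two_pow]

/-- The sums of distinct numbers `2 ^ j - 1`, `j ≥ 1`, are the values of `mersenneSum`, as the set
of the indices `j` is the set of places of the ones in a binary expansion. -/
theorem exists_sum_two_pow_sub_one_iff {n : ℕ} :
    (∃ J : Finset ℕ, (∀ j ∈ J, 1 ≤ j) ∧ n = ∑ j ∈ J, (2 ^ j - 1)) ↔
      n ∈ Set.range mersenneSum := by
  constructor
  · rintro ⟨J, hJ, rfl⟩
    have hinj : Set.InjOn (fun j => j - 1) (J : Set ℕ) := fun i hi j hj hij => by
      have h1 := hJ i hi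
      have h2 := hJ j hj
      dsimp only at hij
      omega
    refine ⟨∑ i ∈ J.image (fun j => j - 1), 2 ^ i, ?_⟩
    rw [mersenneSum_sum_two_pow, Finset.sum_image hinj]
    exact Finset.sum_congr rfl fun j hj => by rw [Nat.sub_add_cancel (hJ j hj)]
  · rintro ⟨m, rfl⟩
    refine ⟨m.bitIndices.toFinset.map (addRightEmbedding 1), ?_, ?_⟩
    · simp
    · rw [← Finset.sum_toFinset_bitIndices_two_pow m, mersenneSum_sum_two_pow]
      simp

open Classical in
theorem carlitzSeq_eq (K : Type*) [Field K] (n : ℕ) :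
    carlitzSeq K n = if n ∈ Set.range mersenneSum then 1 else 0 := by
  rw [carlitzSeq, exists_sum_two_pow_sub_one_iff]
  refine if_congr (or_iff_right_of_imp ?_) rfl rfl
  rintro rfl
  exact ⟨0, mersenneSum_zero⟩

theorem carlitzSeq_eq_iff (K : Type*) [Field K] {m n : ℕ} :
    carlitzSeq K m = carlitzSeq K n ↔
      (m ∈ Set.range mersenneSum ↔ n ∈ Set.range mersenneSum) := by
  rw [carlitzSeq_eq, carlitzSeq_eq]
  split_ifs with h1 h2 h2 <;> simp [h1, h2]

/-- Every `n` is a sum of distinct numbers `2 ^ (j + 1) - 1` in at most one way, so the coefficients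
of the finite products are `0` or `1`, and they agree with `carlitzSeq` at small indices. -/
theorem coeff_prod_one_add_X_pow (K : Type*) [Field K] {D n : ℕ} (hn : n < D) {s : Finset ℕ}
    (hs : Finset.range D ⊆ s) :
    PowerSeries.coeff n (∏ j ∈ s, (1 + (PowerSeries.X : PowerSeries K) ^ (2 ^ (j + 1) - 1)))
      = carlitzSeq K n := by
  classical
  simp_rw [Finset.prod_one_add, Finset.prod_pow_eq_pow_sum, map_sum, PowerSeries.coeff_X_pow,
    ← mersenneSum_sum_two_pow, carlitzSeq_eq]
  split_ifs with h
  · obtain ⟨m, rfl⟩ := h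
    have hm : m.bitIndices.toFinset ∈ s.powerset := by
      rw [Finset.mem_powerset]
      refine fun i hi => hs (Finset.mem_range.2 ?_)
      have h1 := Nat.two_pow_le_of_mem_bitIndices (List.mem_toFinset.1 hi)
      have h2 : m ≤ mersenneSum m := mersenneSum_strictMono.le_apply
      have h3 : i < 2 ^ i := Nat.lt_two_pow_self
      omega
    rw [Finset.sum_eq_single_of_mem _ hm, if_pos (by rw [Finset.sum_toFinset_bitIndices_two_pow])]
    intro t _ ht
    refine if_neg fun h => ht ?_
    rw [mersenneSum_strictMono.injective h, Finset.toFinset_bitIndices_sum_two_pow]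
  · exact Finset.sum_eq_zero fun t _ => if_neg fun h1 => h ⟨_, h1.symm⟩

/-! ### Runs of zeros and aligned blocks -/

theorem mersenneSum_add_le {m n : ℕ} (h : m ≤ n) : mersenneSum m + (n - m) ≤ mersenneSum n := by
  obtain ⟨d, rfl⟩ := Nat.exists_eq_add_of_le h
  simpa [add_comm] using mersenneSum_strictMono.add_le_nat d m

/-- Runs of `R` zeros followed by a one in the indicator word of the range of `mersenneSum` end at
the values of `mersenneSum` at multiples of `2 ^ R`, hence are at distance at least `2 ^ R`. So a
factor of length `Q ≤ 2 ^ R` that contains such a run determines the place of the run. -/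
theorem offset_eq_of_block_eq {Q R n n' o o' m m' : ℕ} (hR : 0 < R) (hQ : Q ≤ 2 ^ R)
    (ho : R ≤ o) (hlt : o < o') (ho' : o' < Q) (hm0 : 0 < m)
    (hm : 2 ^ R ∣ m) (hm' : 2 ^ R ∣ m')
    (h : mersenneSum m = Q * n + o) (h' : mersenneSum m' = Q * n' + o')
    (hb : ∀ r < Q, Q * n + r ∈ Set.range mersenneSum ↔ Q * n' + r ∈ Set.range mersenneSum) :
    False := by
  obtain ⟨l, hl⟩ := (hb o (by omega)).1 ⟨m, h⟩
  have hl0 : l ≠ 0 := by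
    rintro rfl
    rw [mersenneSum_zero] at hl
    omega
  obtain ⟨l, rfl⟩ := Nat.exists_eq_succ_of_ne_zero hl0
  obtain ⟨m, rfl⟩ := Nat.exists_eq_succ_of_ne_zero hm0.ne'
  rw [Nat.succ_eq_add_one] at *
  have hgap := mersenneSum_add_lt_succ_iff.2 hm
  have hdvd : 2 ^ R ∣ l + 1 := by
    rw [← mersenneSum_add_lt_succ_iff]
    by_contra hcon
    have h1 := mersenneSum_lt_succ l
    -- the preceding value lies in the same block, and the equality of the blocks transports it
    -- into the run of zeros that ends at `mersenneSum (m + 1)`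
    obtain ⟨r, hr⟩ : ∃ r, mersenneSum l = Q * n' + r :=
      Nat.exists_eq_add_of_le (by omega)
    obtain ⟨i, hi⟩ := (hb r (by omega)).2 ⟨l, hr⟩
    have h2 : i < m + 1 := mersenneSum_strictMono.lt_iff_lt.1 (by omega)
    have h3 := mersenneSum_strictMono.monotone (Nat.lt_succ_iff.1 h2)
    omega
  have hlm : l + 1 < m' := mersenneSum_strictMono.lt_iff_lt.1 (by omega)
  have h4 : 2 ^ R ≤ m' - (l + 1) :=
    Nat.le_of_dvd (by omega) (Nat.dvd_sub hm' hdvd)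
  have h5 := mersenneSum_add_le hlm.le
  omega

/-- For `q = 2 ^ e`, the runs ending at `mersenneSum (2 ^ R * (2 ^ c - 1))` have the offset `-c`
modulo `q ^ k`. -/
theorem exists_mersenneSum_eq_of_two_pow {e k R c : ℕ} (hR : e * k ≤ R) (hc : 0 < c)
    (hcQ : c < (2 ^ e) ^ k) :
    ∃ m n, 0 < m ∧ 2 ^ R ∣ m ∧ mersenneSum m = (2 ^ e) ^ k * n + ((2 ^ e) ^ k - c) := by
  have hpos : 1 ≤ 2 ^ c - 1 := Nat.le_sub_one_of_lt (Nat.one_lt_two_pow hc.ne')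
  refine ⟨2 ^ R * (2 ^ c - 1), 2 ^ (R - e * k) * (2 * (2 ^ c - 1)) - 1, by positivity,
    dvd_mul_right _ _, ?_⟩
  have h := mersenneSum_two_pow_mul (mersenneSum_two_pow_sub_one c) R
  rw [← pow_mul] at *
  have h1 : 2 * (2 ^ R * (2 ^ c - 1))
      = 2 ^ (e * k) * (2 ^ (R - e * k) * (2 * (2 ^ c - 1))) := by
    rw [← mul_assoc (2 ^ (e * k)), ← pow_add, Nat.add_sub_cancel' hR]
    ring
  have h2 : 1 ≤ 2 ^ (R - e * k) * (2 * (2 ^ c - 1)) := Nat.succ_le_of_lt (by positivity)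
  have h3 := Nat.mul_succ (2 ^ (e * k)) (2 ^ (R - e * k) * (2 * (2 ^ c - 1)) - 1)
  rw [Nat.succ_eq_add_one, Nat.sub_add_cancel h2] at h3
  omega

/-- For odd `q`, some runs ending at `mersenneSum (2 ^ N)` have the offset `2 ^ b - 1` modulo
`q ^ k`, as the powers of `2` are periodic modulo `q ^ k`. -/
theorem exists_mersenneSum_eq_of_odd {q k R b : ℕ} (hq : Odd q) (hb : 2 ^ b ≤ q ^ k) :
    ∃ m n, 0 < m ∧ 2 ^ R ∣ m ∧ mersenneSum m = q ^ k * n + (2 ^ b - 1) := by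
  have hcop : Nat.Coprime 2 (q ^ k) := (Nat.coprime_two_left.2 hq).pow_right k
  have hφ : 0 < (q ^ k).totient := Nat.totient_pos.2 (by have := Nat.one_le_two_pow (n := b); omega)
  set t := (q ^ k).totient * (R + 1) with ht
  have hRt : R + 1 ≤ t := Nat.le_mul_of_pos_left _ hφ
  have hmod : 2 ^ b ≡ 2 ^ (b + t) [MOD q ^ k] := by
    have h := ((Nat.ModEq.pow_totient hcop).pow (R + 1)).mul_left (2 ^ b)
    rw [one_pow, mul_one, ← pow_mul, ← pow_add] at h
    exact h.symm
  have hle : 2 ^ b ≤ 2 ^ (b + t) := Nat.pow_le_pow_right two_pos (by omega)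
  obtain ⟨n, hn⟩ := (Nat.modEq_iff_dvd' hle).1 hmod
  refine ⟨2 ^ (b + t - 1), n, by positivity, pow_dvd_pow 2 (by omega), ?_⟩
  have h := mersenneSum_two_pow_mul (mersenneSum_two_pow_sub_one 1) (b + t - 1)
  simp only [pow_one, Nat.add_one_sub_one, mul_one, ← pow_succ'] at h
  rw [Nat.sub_add_cancel (by omega)] at h
  have := Nat.one_le_two_pow (n := b)
  omega

/-- The indicator word of the range of `mersenneSum` is not `q`-automatic, for `q` a prime power.
Automaticity enters through a map `σ` to a finite set whose value at `n` determines, for every `k`,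
the block `[q ^ k * n, q ^ k * (n + 1))` of the word. -/
theorem not_block_determined {q : ℕ} (hq : IsPrimePow q) {S : Type*} [Finite S] (σ : ℕ → S)
    (hσ : ∀ k n n', σ n = σ n' → ∀ r < q ^ k,
      (q ^ k * n + r ∈ Set.range mersenneSum ↔ q ^ k * n' + r ∈ Set.range mersenneSum)) :
    False := by
  have hq2 : 2 ≤ q := hq.two_le
  set B := Nat.card S
  -- `k = x + B`, where `x` is so large that `B + 1` offsets fit between `R = q * k` and `q ^ k`
  obtain ⟨x, hx⟩ : ∃ x, q * (x + B) + B + 2 ≤ 2 ^ x := by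
    have h1 : q + B + 2 < 2 ^ (q + B + 2) := Nat.lt_two_pow_self
    refine ⟨2 * (q + B + 2) + 2, ?_⟩
    rw [pow_add, pow_mul']
    nlinarith [Nat.zero_le (q * B), Nat.zero_le (B * B), Nat.zero_le (q * q)]
  set k := x + B with hk
  set R := q * k with hR
  have hxk : 2 ^ k ≤ q ^ k := Nat.pow_le_pow_left hq2 k
  have hxk' : 2 ^ x ≤ 2 ^ k := Nat.pow_le_pow_right two_pos (by omega)
  have hQ : q ^ k ≤ 2 ^ R := by
    rw [hR, pow_mul]
    exact Nat.pow_le_pow_left Nat.lt_two_pow_self.le k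
  have hRpos : 0 < R := by
    rcases Nat.eq_zero_or_pos x with rfl | h
    · simp at hx
    · positivity
  have key : ∃ o : Fin (B + 1) → ℕ, Function.Injective o ∧ ∀ t, R ≤ o t ∧ o t < q ^ k ∧
      ∃ m n, 0 < m ∧ 2 ^ R ∣ m ∧ mersenneSum m = q ^ k * n + o t := by
    rcases q.even_or_odd with he | ho
    · obtain ⟨p, e, hp, -, rfl⟩ := (isPrimePow_nat_iff _).1 hq
      obtain rfl : p = 2 := by
        rw [Nat.even_iff, ← Nat.dvd_iff_mod_eq_zero] at he
        exact ((Nat.prime_dvd_prime_iff_eq Nat.prime_two hp).1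
          (Nat.prime_two.dvd_of_dvd_pow he)).symm
      refine ⟨fun t => (2 ^ e) ^ k - (t + 1), fun t t' h => ?_, fun t => ⟨?_, ?_, ?_⟩⟩
      · simp only at h
        ext
        omega
      · dsimp only
        omega
      · dsimp only
        omega
      · refine exists_mersenneSum_eq_of_two_pow ?_ (by omega) (by omega)
        exact Nat.mul_le_mul_right _ Nat.lt_two_pow_self.le
    · have hb : ∀ t : Fin (B + 1), 2 ^ x ≤ 2 ^ (x + t) ∧ 2 ^ (x + t) ≤ q ^ k := fun t =>
        ⟨Nat.pow_le_pow_right two_pos (by omega),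
          (Nat.pow_le_pow_right two_pos (by omega)).trans hxk⟩
      refine ⟨fun t => 2 ^ (x + t) - 1, fun t t' h => ?_, fun t => ⟨?_, ?_, ?_⟩⟩
      · have h1 := hb t
        have h2 := hb t'
        simp only at h
        have h3 : 2 ^ (x + t) = 2 ^ (x + t') := by omega
        have := Nat.pow_right_injective le_rfl h3
        ext
        omega
      · have := hb t
        dsimp only
        omega
      · have := hb t
        dsimp only
        omega
      · exact exists_mersenneSum_eq_of_odd ho (hb t).2
  obtain ⟨o, hinj, ho⟩ := key
  choose hRo hoQ m n hm0 hm h using ho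
  obtain ⟨t, t', hne, heq⟩ : ∃ t t', t ≠ t' ∧ σ (n t) = σ (n t') := by
    by_contra! hcon
    have := Nat.card_le_card_of_injective (fun t => σ (n t))
      (fun t t' htt => by_contra fun hn => hcon t t' hn htt)
    simp [B] at this
  rcases lt_or_gt_of_ne (hinj.ne hne) with hlt | hlt
  · exact offset_eq_of_block_eq hRpos hQ (hRo t) hlt (hoQ t') (hm0 t) (hm t) (hm t') (h t) (h t')
      (hσ k _ _ heq)
  · exact offset_eq_of_block_eq hRpos hQ (hRo t') hlt (hoQ t) (hm0 t') (hm t') (hm t) (h t') (h t)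
      (hσ k _ _ heq.symm)

/-! ### Cartier operators and algebraic power series -/

namespace PowerSeries

/-- The power series that are polynomials of degree at most `D`. -/
def degreeLE (K : Type*) [Field K] (D : ℕ) : Submodule K K⟦X⟧ where
  carrier := {h | ∀ n, D < n → coeff n h = 0}
  zero_mem' := by simp
  add_mem' {f g} hf hg n hn := by rw [map_add, hf n hn, hg n hn, add_zero]
  smul_mem' c f hf n hn := by rw [coeff_smul, hf n hn, smul_zero]

variable {K : Type*} [Field K]

theorem degreeLE_mono {D E : ℕ} (hDE : D ≤ E) : degreeLE K D ≤ degreeLE K E :=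
  fun _ hh n hn => hh n (hDE.trans_lt hn)

theorem mul_mem_degreeLE {D E : ℕ} {g h : K⟦X⟧} (hg : g ∈ degreeLE K D) (hh : h ∈ degreeLE K E) :
    g * h ∈ degreeLE K (D + E) := by
  intro n hn
  rw [coeff_mul]
  refine Finset.sum_eq_zero fun x hx => ?_
  rw [Finset.HasAntidiagonal.mem_antidiagonal] at hx
  by_cases h1 : D < x.1
  · rw [hg _ h1, zero_mul]
  · rw [hh _ (by omega), mul_zero]

theorem coe_mem_degreeLE {D : ℕ} {p : Polynomial K} (hp : p.natDegree ≤ D) :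
    (p : K⟦X⟧) ∈ degreeLE K D := fun n hn => by
  rw [Polynomial.coeff_coe, Polynomial.coeff_eq_zero_of_natDegree_lt (hp.trans_lt hn)]

theorem exists_pow_mem_degreeLE {D : ℕ} {h : K⟦X⟧} (hh : h ∈ degreeLE K D) (n : ℕ) :
    ∃ E, h ^ n ∈ degreeLE K E := by
  induction n with
  | zero => exact ⟨0, fun n hn => by rw [pow_zero, coeff_one, if_neg hn.ne']⟩
  | succ n ih =>
    obtain ⟨E, hE⟩ := ih
    exact ⟨E + D, pow_succ h n ▸ mul_mem_degreeLE hE hh⟩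

instance [Finite K] (D : ℕ) : Finite (degreeLE K D) := by
  refine Finite.of_injective (fun h (i : Fin (D + 1)) => coeff i h.1) fun g h hgh => ?_
  ext n
  by_cases hn : D < n
  · rw [g.2 n hn, h.2 n hn]
  · exact congrFun hgh ⟨n, by omega⟩

/-- The Cartier operator `∑ aₙ Xⁿ ↦ ∑ a_{q n + r} Xⁿ`. -/
noncomputable def cartier (K : Type*) [Field K] (q r : ℕ) : K⟦X⟧ →ₗ[K] K⟦X⟧ where
  toFun f := mk fun n => coeff (q * n + r) f
  map_add' f g := by ext; simp
  map_smul' c f := by ext; simp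

@[simp] theorem coeff_cartier (q r n : ℕ) (f : K⟦X⟧) :
    coeff n (cartier K q r f) = coeff (q * n + r) f := by simp [cartier]

theorem cartier_mul_expand {q r : ℕ} (hq : q ≠ 0) (hr : r < q) (h g : K⟦X⟧) :
    cartier K q r (h * expand q hq g) = cartier K q r h * g := by
  ext n
  rw [coeff_cartier, coeff_mul, coeff_mul]
  symm
  refine Finset.sum_of_injOn (fun x => (q * x.1 + r, q * x.2)) ?_ ?_ ?_ ?_
  · rintro ⟨a, b⟩ - ⟨a', b'⟩ - hab
    simp only [Prod.mk.injEq, add_left_inj, mul_eq_mul_left_iff, hq, or_false] at hab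
    exact Prod.ext hab.1 hab.2
  · rintro ⟨a, b⟩ hab
    simp only [Finset.mem_coe, Finset.HasAntidiagonal.mem_antidiagonal] at hab ⊢
    rw [← hab]
    ring
  · rintro ⟨a, b⟩ hab hnot
    rw [Finset.HasAntidiagonal.mem_antidiagonal] at hab
    by_cases hdvd : q ∣ b
    · obtain ⟨j, rfl⟩ := hdvd
      dsimp only at hab
      have hj : j ≤ n := by
        have h1 : q * j < q * (n + 1) := by rw [mul_add, mul_one]; omega
        exact Nat.lt_succ_iff.1 (Nat.lt_of_mul_lt_mul_left h1)
      obtain ⟨i, rfl⟩ := Nat.exists_eq_add_of_le' hj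
      refine absurd ⟨(i, j), ?_, ?_⟩ hnot
      · simp
      · rw [mul_add] at hab
        simp only [Prod.mk.injEq, and_true]
        omega
    · rw [coeff_expand_of_not_dvd q hq _ hdvd, mul_zero]
  · rintro ⟨a, b⟩ -
    simp only [coeff_cartier, coeff_expand_mul]

theorem cartier_mem_degreeLE {q r D : ℕ} (hq : 2 ≤ q) {h : K⟦X⟧} (hh : h ∈ degreeLE K (D + D)) :
    cartier K q r h ∈ degreeLE K D := fun n hn => by
  rw [coeff_cartier]
  exact hh _ (by nlinarith)

theorem exists_cartier_ne_zero {q : ℕ} (hq : 0 < q) {h : K⟦X⟧} (hh : h ≠ 0) :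
    ∃ r < q, cartier K q r h ≠ 0 := by
  obtain ⟨n, hn⟩ := exists_coeff_ne_zero_iff_ne_zero.2 hh
  refine ⟨n % q, Nat.mod_lt _ hq, fun h0 => hn ?_⟩
  have := coeff_cartier q (n % q) (n / q) h
  rw [h0, Nat.div_add_mod] at this
  simpa using this.symm

/-- The values at `n` of all series of a set stable under the Cartier operators determine the
coefficients of these series in the block `[q ^ k * n, q ^ k * (n + 1))`. -/
theorem coeff_block_eq {V : Set K⟦X⟧} {q : ℕ} (hq : 0 < q)
    (hV : ∀ r < q, ∀ h ∈ V, cartier K q r h ∈ V) {n n' : ℕ}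
    (hn : ∀ h ∈ V, coeff n h = coeff n' h) (k : ℕ) :
    ∀ r < q ^ k, ∀ h ∈ V, coeff (q ^ k * n + r) h = coeff (q ^ k * n' + r) h := by
  induction k with
  | zero =>
    intro r hr h hh
    obtain rfl : r = 0 := by simpa using hr
    simpa using hn h hh
  | succ k ih =>
    intro r hr h hh
    have h1 : ∀ m, q ^ (k + 1) * m + r = q * (q ^ k * m + r / q) + r % q := fun m => by
      conv_lhs => rw [← Nat.div_add_mod r q]
      ring
    rw [h1, h1, ← coeff_cartier q, ← coeff_cartier q]
    exact ih _ (Nat.div_lt_of_lt_mul (by rwa [pow_succ'] at hr)) _ (hV _ (Nat.mod_lt _ hq) h hh)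

variable [Finite K]

theorem expand_card (f : K⟦X⟧) : expand (Nat.card K) Nat.card_pos.ne' f = f ^ Nat.card K := by
  obtain ⟨p, hp⟩ := CharP.exists K
  have := Fintype.ofFinite K
  rcases FiniteField.card K p with ⟨⟨n, npos⟩, ⟨hp, hn⟩⟩
  have : Fact p.Prime := ⟨hp⟩
  rw [Fintype.card_eq_nat_card] at hn
  dsimp at hn
  have key := MvPowerSeries.map_iterateFrobenius_expand p hp.ne_zero f n
  have hid : iterateFrobenius K p n = RingHom.id K := by
    ext x
    rw [iterateFrobenius_def, ← hn, ← Fintype.card_eq_nat_card, FiniteField.pow_card,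
      RingHom.id_apply]
  rw [hid, MvPowerSeries.map_id] at key
  simp only [hn]
  exact key

theorem cartier_mul_pow_card {r : ℕ} (hr : r < Nat.card K) (h g : K⟦X⟧) :
    cartier K (Nat.card K) r (h * g ^ Nat.card K) = cartier K (Nat.card K) r h * g := by
  rw [← expand_card, cartier_mul_expand _ hr]

/-- A linear relation between the powers `f ^ (q ^ i)` can be chosen such that `f` itself occurs:
the Cartier operators take `q`-th roots of a relation without this term. -/
theorem exists_relation_zero_ne_zero {f : K⟦X⟧} {d D : ℕ} {a : ℕ → K⟦X⟧}
    (ha : ∀ i, a i ∈ degreeLE K D) (hne : ∃ i < d, a i ≠ 0)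
    (hrel : ∑ i ∈ Finset.range d, a i * f ^ Nat.card K ^ i = 0) :
    ∃ (d : ℕ) (b : ℕ → K⟦X⟧), (∀ i, b i ∈ degreeLE K D) ∧ b 0 ≠ 0 ∧
      ∑ i ∈ Finset.range (d + 1), b i * f ^ Nat.card K ^ i = 0 := by
  induction d generalizing a with
  | zero => simp at hne
  | succ d ih =>
    by_cases h0 : a 0 = 0
    · obtain ⟨i, hi, hai⟩ := hne
      obtain ⟨i, rfl⟩ := Nat.exists_eq_succ_of_ne_zero (n := i) (by rintro rfl; exact hai h0)
      obtain ⟨r, hr, hri⟩ := exists_cartier_ne_zero (Nat.card_pos (α := K)) hai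
      refine ih (a := fun i => cartier K (Nat.card K) r (a (i + 1))) (fun i => ?_)
        ⟨i, by omega, hri⟩ ?_
      · exact cartier_mem_degreeLE Finite.one_lt_card (degreeLE_mono (by omega) (ha (i + 1)))
      · rw [Finset.sum_range_succ', h0, zero_mul, add_zero] at hrel
        have := congrArg (cartier K (Nat.card K) r) hrel
        rw [map_sum, map_zero] at this
        rw [← this]
        refine Finset.sum_congr rfl fun i _ => ?_
        rw [pow_succ, pow_mul, cartier_mul_pow_card hr]
    · exact ⟨d, a, ha, h0, hrel⟩

/-- The series `h` such that `h = ∑_{i ≤ d} c i * (f / A) ^ (q ^ i)`, with polynomials `c i` of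
degree at most `E`; the equation is multiplied by `A ^ (q ^ d)` to avoid denominators. -/
def combinationSet (A f : K⟦X⟧) (d E : ℕ) : Set K⟦X⟧ :=
  {h | ∃ c : ℕ → K⟦X⟧, (∀ i, c i ∈ degreeLE K E) ∧
    A ^ Nat.card K ^ d * h = ∑ i ∈ Finset.range (d + 1),
      c i * (A ^ (Nat.card K ^ d - Nat.card K ^ i) * f ^ Nat.card K ^ i)}

theorem finite_combinationSet {A : K⟦X⟧} (hA : A ≠ 0) (f : K⟦X⟧) (d E : ℕ) :
    (combinationSet A f d E).Finite := by
  let φ : (Fin (d + 1) → degreeLE K E) → K⟦X⟧ := fun c => ∑ i : Fin (d + 1),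
    (c i : K⟦X⟧) * (A ^ (Nat.card K ^ d - Nat.card K ^ (i : ℕ)) * f ^ Nat.card K ^ (i : ℕ))
  have hinj : Function.Injective fun h : K⟦X⟧ => A ^ Nat.card K ^ d * h :=
    mul_right_injective₀ (pow_ne_zero _ hA)
  refine ((Set.finite_range φ).preimage hinj.injOn).subset ?_
  rintro h ⟨c, hc, h1⟩
  refine ⟨fun i => ⟨c i, hc i⟩, ?_⟩
  simp only [φ, h1]
  rw [Finset.sum_range]

/-- If `A * f = ∑_{i < d} b i * f ^ (q ^ (i + 1))`, then `g = f / A` satisfies the monic equation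
`g = ∑_{i < d} b i * A ^ (q ^ (i + 1) - 2) * g ^ (q ^ (i + 1))`. Hence a Cartier operator, which
divides degrees by `q`, preserves the combinations of the `g ^ (q ^ i)` of bounded degree. -/
theorem cartier_mem_combinationSet {A f : K⟦X⟧} {d E r : ℕ} {b : ℕ → K⟦X⟧}
    (hr : r < Nat.card K)
    (hb : ∀ i, i < d → b i * A ^ (Nat.card K ^ (i + 1) - 2) ∈ degreeLE K E)
    (hrel : A * f = ∑ i ∈ Finset.range d, b i * f ^ Nat.card K ^ (i + 1))
    {h : K⟦X⟧} (hh : h ∈ combinationSet A f d E) :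
    cartier K (Nat.card K) r h ∈ combinationSet A f d E := by
  obtain ⟨c, hc, hch⟩ := hh
  have hq : 2 ≤ Nat.card K := Finite.one_lt_card
  set q := Nat.card K with hqdef
  have hpow : ∀ {i j : ℕ}, i ≤ j → q ^ i ≤ q ^ j := fun h => Nat.pow_le_pow_right (by omega) h
  have hq1 : ∀ i, 2 ≤ q ^ (i + 1) := fun i => by
    calc 2 ≤ q ^ 1 := by simpa using hq
      _ ≤ _ := hpow (by omega)
  set e : ℕ → K⟦X⟧ := fun i => b i * A ^ (q ^ (i + 1) - 2) with he
  -- the equation for `h`, cleared of denominators and without the term in `f ^ (q ^ 0)`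
  have key : h * (A ^ q ^ d) ^ q = ∑ i ∈ Finset.range d,
      (c 0 * e i + c (i + 1)) * (A ^ (q ^ d - q ^ i) * f ^ q ^ i) ^ q := by
    have hG : ∀ i, (A ^ (q ^ d - q ^ i) * f ^ q ^ i) ^ q
        = A ^ (q ^ (d + 1) - q ^ (i + 1)) * f ^ q ^ (i + 1) := fun i => by
      rw [mul_pow, ← pow_mul, ← pow_mul, Nat.sub_mul, ← pow_succ, ← pow_succ]
    have hG0 : A ^ (q ^ (d + 1) - 1) * f = ∑ i ∈ Finset.range d,
        e i * (A ^ (q ^ d - q ^ i) * f ^ q ^ i) ^ q := by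
      have h1 : q ^ (d + 1) - 1 = q ^ (d + 1) - 2 + 1 := by have := hq1 d; omega
      rw [h1, pow_succ, mul_assoc, hrel, Finset.mul_sum]
      refine Finset.sum_congr rfl fun i hi => ?_
      rw [Finset.mem_range] at hi
      rw [hG i]
      have h2 : q ^ (d + 1) - 2 = q ^ (i + 1) - 2 + (q ^ (d + 1) - q ^ (i + 1)) := by
        have := hq1 i
        have := hpow (show i + 1 ≤ d + 1 by omega)
        omega
      rw [h2, pow_add]
      ring
    have hd := hpow (show d ≤ d + 1 by omega)
    calc h * (A ^ q ^ d) ^ q = A ^ (q ^ (d + 1) - q ^ d) * (A ^ q ^ d * h) := by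
          rw [← pow_mul, ← pow_succ, ← mul_assoc, ← pow_add, Nat.sub_add_cancel hd, mul_comm]
      _ = ∑ i ∈ Finset.range (d + 1), c i * (A ^ (q ^ (d + 1) - q ^ i) * f ^ q ^ i) := by
          rw [hch, Finset.mul_sum]
          refine Finset.sum_congr rfl fun i hi => ?_
          have h3 : q ^ (d + 1) - q ^ i = q ^ (d + 1) - q ^ d + (q ^ d - q ^ i) := by
            have := hpow (show i ≤ d from Nat.lt_succ_iff.1 (Finset.mem_range.1 hi))
            omega
          rw [h3, pow_add]
          ring
      _ = _ := by
          rw [Finset.sum_range_succ', pow_zero, pow_one, hG0, Finset.mul_sum,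
            ← Finset.sum_add_distrib]
          refine Finset.sum_congr rfl fun i _ => ?_
          rw [← hG i]
          ring
  refine ⟨fun i => if i < d then cartier K q r (c 0 * e i + c (i + 1)) else 0, fun i => ?_, ?_⟩
  · dsimp only
    split_ifs with hi
    · exact cartier_mem_degreeLE hq (add_mem (mul_mem_degreeLE (hc 0) (hb i hi))
        (degreeLE_mono (by omega) (hc _)))
    · exact zero_mem _
  · beta_reduce
    rw [Finset.sum_range_succ, if_neg (lt_irrefl d), zero_mul, add_zero, mul_comm,
      ← cartier_mul_pow_card hr, ← hqdef, key, map_sum]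
    refine Finset.sum_congr rfl fun i hi => ?_
    rw [cartier_mul_pow_card hr, if_pos (Finset.mem_range.1 hi)]

/-- The direction of Christol's theorem from algebraicity to automaticity: a series that satisfies
a linear relation between its powers `f ^ (q ^ i)` lies in a finite set stable under the Cartier
operators. -/
theorem exists_finite_cartier_stable {f : K⟦X⟧} {d D : ℕ} {a : ℕ → K⟦X⟧}
    (ha : ∀ i, a i ∈ degreeLE K D) (hne : ∃ i < d, a i ≠ 0)
    (hrel : ∑ i ∈ Finset.range d, a i * f ^ Nat.card K ^ i = 0) :
    ∃ V : Set K⟦X⟧, V.Finite ∧ f ∈ V ∧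
      ∀ r < Nat.card K, ∀ h ∈ V, cartier K (Nat.card K) r h ∈ V := by
  obtain ⟨d, b, hb, hb0, hrel⟩ := exists_relation_zero_ne_zero ha hne hrel
  rw [Finset.sum_range_succ', pow_zero, pow_one, add_comm, add_eq_zero_iff_eq_neg,
    ← Finset.sum_neg_distrib] at hrel
  simp_rw [← neg_mul] at hrel
  choose E hE using fun i => exists_pow_mem_degreeLE (hb 0) (Nat.card K ^ (i + 1) - 2)
  set M := D + (Finset.range d).sup E
  refine ⟨combinationSet (b 0) f d M, finite_combinationSet hb0 f d M, ?_, fun r hr h hh =>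
    cartier_mem_combinationSet hr (fun i hi => ?_) hrel hh⟩
  · refine ⟨fun i => if i = 0 then b 0 else 0, fun i => ?_, ?_⟩
    · dsimp only
      split_ifs
      · exact degreeLE_mono (by omega) (hb 0)
      · exact zero_mem _
    · have h1 : Nat.card K ^ d = Nat.card K ^ d - 1 + 1 :=
        (Nat.sub_add_cancel (Nat.one_le_pow _ _ Nat.card_pos)).symm
      rw [Finset.sum_range_succ']
      simp only [Nat.add_eq_zero_iff, one_ne_zero, and_false, if_false, zero_mul,
        Finset.sum_const_zero, if_true, pow_zero, pow_one, zero_add]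
      rw [h1, pow_succ, Nat.add_sub_cancel]
      ring
  · refine degreeLE_mono ?_ (mul_mem_degreeLE (neg_mem (hb (i + 1))) (hE i))
    exact Nat.add_le_add_left (Finset.le_sup (f := E) (Finset.mem_range.2 hi)) D

end PowerSeries

/-! ### Algebraic elements of `K((T⁻¹))` -/

namespace LaurentSeriesAtInfty

variable {K : Type*} [Field K]

/-- The embedding of power series in `K((T⁻¹))`, the variable being sent to `T⁻¹`. -/
noncomputable def ofPowerSeries (K : Type*) [Field K] : PowerSeries K →+* LaurentSeriesAtInfty K :=
  (HahnSeries.ofPowerSeries ℤ K : PowerSeries K →+* LaurentSeries K)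

theorem ofPowerSeries_injective : Function.Injective (ofPowerSeries K) :=
  HahnSeries.ofPowerSeries_injective

theorem T_ne_zero : T K ≠ 0 :=
  (HahnSeries.single_ne_zero one_ne_zero :
    (HahnSeries.single (-1 : ℤ) (1 : K) : LaurentSeries K) ≠ 0)

theorem ofPowerSeries_X : ofPowerSeries K PowerSeries.X = (T K)⁻¹ := by
  refine eq_inv_of_mul_eq_one_left ?_
  change (HahnSeries.ofPowerSeries ℤ K PowerSeries.X * HahnSeries.single (-1 : ℤ) (1 : K) :
    LaurentSeries K) = 1
  rw [HahnSeries.ofPowerSeries_X, HahnSeries.single_mul_single]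
  simp

theorem ofPowerSeries_C (c : K) : ofPowerSeries K (PowerSeries.C c) = C K c :=
  HahnSeries.ofPowerSeries_C c

/-- A polynomial in `T` is a power of `T` times the reflected polynomial in `T⁻¹`. -/
theorem ofPowerSeries_reflect {p : Polynomial K} {N : ℕ} (hp : p.natDegree ≤ N) :
    ofPowerSeries K (p.reflect N : Polynomial K) * T K ^ N = ofPolynomial K p := by
  have h : ∀ p : Polynomial K, ofPowerSeries K p = Polynomial.eval₂ (C K) (T K)⁻¹ p := by
    intro p
    have : (ofPowerSeries K).comp Polynomial.coeToPowerSeries.ringHom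
        = Polynomial.eval₂RingHom (C K) (T K)⁻¹ := by
      ext <;> simp [ofPowerSeries_X, ofPowerSeries_C]
    exact congrArg (fun φ : Polynomial K →+* LaurentSeriesAtInfty K => φ p) this
  let _ := invertibleOfNonzero (T_ne_zero (K := K))
  rw [h, ← invOf_eq_inv]
  exact Polynomial.eval₂_reflect_mul_pow (C K) (T K) N p hp

theorem algebraMap_algebraMap (p : Polynomial K) :
    algebraMap (RatFunc K) (LaurentSeriesAtInfty K) (algebraMap (Polynomial K) (RatFunc K) p)
      = ofPolynomial K p := by
  change ofRatFunc K _ = _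
  rw [ofRatFunc, IsFractionRing.lift_algebraMap]

/-- The powers `f ^ (q ^ i)` of an algebraic series are linearly dependent over `K(T)`; clearing
denominators and multiplying by a power of `T⁻¹` gives a relation with coefficients in `K[T⁻¹]`. -/
theorem exists_relation_of_isAlgebraic (q : ℕ) {f : PowerSeries K}
    (hf : IsAlgebraic (RatFunc K) (ofPowerSeries K f)) :
    ∃ (d D : ℕ) (a : ℕ → PowerSeries K), (∀ i, a i ∈ PowerSeries.degreeLE K D) ∧
      (∃ i < d, a i ≠ 0) ∧ ∑ i ∈ Finset.range d, a i * f ^ q ^ i = 0 := by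
  classical
  set F := ofPowerSeries K f
  have hfin : Module.Finite (RatFunc K) (Algebra.adjoin (RatFunc K) {F}) :=
    Module.Finite.iff_fg.2 hf.isIntegral.fg_adjoin_singleton
  have hmem : F ∈ Algebra.adjoin (RatFunc K) {F} := Algebra.self_mem_adjoin_singleton _ _
  have hdep : ¬ LinearIndependent (RatFunc K)
      (fun i : ℕ => (⟨F, hmem⟩ : Algebra.adjoin (RatFunc K) {F}) ^ q ^ i) := fun h =>
    not_finite_iff_infinite.2 inferInstance h.finite
  rw [not_linearIndependent_iff] at hdep
  obtain ⟨s, g, hrel, i₀, hi₀, hg₀⟩ := hdep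
  obtain ⟨b, hb⟩ := IsLocalization.exist_integer_multiples (nonZeroDivisors (Polynomial K)) s g
  choose! p hp using hb
  obtain ⟨d, hd⟩ := s.exists_nat_subset_range
  set N := s.sup fun i => (p i).natDegree
  have hN : ∀ i ∈ s, (p i).natDegree ≤ N := fun i hi =>
    Finset.le_sup (f := fun i => (p i).natDegree) hi
  refine ⟨d, N, fun i => if i ∈ s then ((p i).reflect N : Polynomial K) else 0, fun i => ?_,
    ⟨i₀, Finset.mem_range.1 (hd hi₀), ?_⟩, ?_⟩
  · dsimp only
    split_ifs with hi
    · exact PowerSeries.coe_mem_degreeLE (Polynomial.natDegree_reflect_le.trans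
        (max_le le_rfl (hN i hi)))
    · exact zero_mem _
  · beta_reduce
    rw [if_pos hi₀]
    intro h0
    rw [Polynomial.coe_eq_zero_iff, Polynomial.reflect_eq_zero_iff] at h0
    have h1 := hp i₀ hi₀
    rw [h0, map_zero, eq_comm, Algebra.smul_def] at h1
    refine mul_ne_zero ?_ hg₀ h1
    exact IsLocalization.to_map_ne_zero_of_mem_nonZeroDivisors _ le_rfl b.2
  · apply ofPowerSeries_injective
    apply mul_right_cancel₀ (pow_ne_zero N (T_ne_zero (K := K)))
    beta_reduce
    rw [map_zero, zero_mul, map_sum, Finset.sum_mul,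
      ← Finset.sum_subset hd fun i _ hi => by rw [if_neg hi, zero_mul, map_zero, zero_mul]]
    have h2 := congrArg (fun z : Algebra.adjoin (RatFunc K) {F} =>
      algebraMap (RatFunc K) _ (algebraMap (Polynomial K) (RatFunc K) b) *
        (z : LaurentSeriesAtInfty K)) hrel
    simp only [ZeroMemClass.coe_zero, mul_zero, AddSubmonoidClass.coe_finsetSum] at h2
    rw [← h2, Finset.mul_sum]
    refine Finset.sum_congr rfl fun i hi => ?_
    have h3 := congrArg (algebraMap (RatFunc K) (LaurentSeriesAtInfty K)) (hp i hi)
    rw [algebraMap_algebraMap, Algebra.smul_def, map_mul] at h3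
    rw [if_pos hi, map_mul, mul_right_comm, ofPowerSeries_reflect (hN i hi), h3, map_pow]
    simp [Algebra.smul_def, mul_assoc, F]

/-! ### The infinite product and the transcendence -/

open MonoidWithZeroHom.ValueGroup₀ in
/-- Convergence of each coefficient, uniformly on initial segments, is convergence for the
`T⁻¹`-adic topology. -/
theorem tendsto_ofPowerSeries {ι : Type*} {l : Filter ι} {g : ι → PowerSeries K}
    {f : PowerSeries K}
    (h : ∀ D : ℕ, ∀ᶠ i in l, ∀ n < D, PowerSeries.coeff n (g i) = PowerSeries.coeff n f) :
    Filter.Tendsto (fun i => ofPowerSeries K (g i)) l (nhds (ofPowerSeries K f)) := by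
  intro U hU
  obtain ⟨γ, hγ⟩ := Valued.mem_nhds.1 hU
  set D : ℤ := -(WithZero.log (embedding γ.1) - 1) with hD
  have hlt : WithZero.exp (-D) < embedding γ.1 := by
    rw [← WithZero.lt_log_iff_exp_lt (by simp), hD]
    simp
  rw [Filter.mem_map]
  filter_upwards [h D.toNat] with i hi
  refine hγ ?_
  change Valued.v.restrict (ofPowerSeries K (g i) - ofPowerSeries K f) < γ.1
  rw [Valuation.restrict_lt_iff_lt_embedding, ← map_sub]
  refine lt_of_le_of_lt ((LaurentSeries.valuation_le_iff_coeff_lt_eq_zero K).2 ?_) hlt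
  intro n hn
  change HahnSeries.coeff ((g i - f : PowerSeries K) : LaurentSeries K) n = 0
  rw [PowerSeries.coeff_coe]
  split_ifs with h0
  · rfl
  · rw [map_sub, hi _ (by omega), sub_self]

theorem ofPowerSeries_mk (a : ℕ → K) : ofPowerSeries K (PowerSeries.mk a) = mk a := rfl

/-- If the series were algebraic, then its coefficients would be automatic, and the state at `n`
(the `n`-th coefficients of the series of a finite set stable under the Cartier operators) would
determine the blocks of length `q ^ k` at `q ^ k * n`. -/
theorem transcendental_mk_carlitzSeq (K : Type*) [Field K] [Finite K] :
    Transcendental (RatFunc K) (mk (carlitzSeq K)) := by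
  intro halg
  have hq : IsPrimePow (Nat.card K) := by
    have := Fintype.ofFinite K
    rw [← Fintype.card_eq_nat_card]
    exact FiniteField.isPrimePow_card K
  rw [← ofPowerSeries_mk] at halg
  obtain ⟨d, D, a, ha, hne, hrel⟩ := exists_relation_of_isAlgebraic (Nat.card K) halg
  obtain ⟨V, hfin, hfV, hV⟩ := PowerSeries.exists_finite_cartier_stable ha hne hrel
  have := hfin.to_subtype
  refine not_block_determined hq (S := V → K) (fun n h => PowerSeries.coeff n h.1)
    fun k n n' hn r hr => ?_
  have h := PowerSeries.coeff_block_eq Nat.card_pos hV (fun h hh => congrFun hn ⟨h, hh⟩) k r hr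
    _ hfV
  rwa [PowerSeries.coeff_mk, PowerSeries.coeff_mk, carlitzSeq_eq_iff] at h

/-- In characteristic `2` the inverse of the factor of index `j` is `1 + T ^ (-(2 ^ j - 1))`. -/
theorem hasProd_carlitzPiFactor :
    HasProd (fun j : ℕ => carlitzPiFactor (ZMod 2) (j + 1)) (mk (carlitzSeq (ZMod 2)))⁻¹ := by
  have hfac : ∀ j : ℕ, carlitzPiFactor (ZMod 2) (j + 1) = (ofPowerSeries (ZMod 2)
      (1 + (PowerSeries.X : PowerSeries (ZMod 2)) ^ (2 ^ (j + 1) - 1)))⁻¹ := fun j => by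
    have h2 : (1 : PowerSeries (ZMod 2)) + PowerSeries.X ^ (2 ^ (j + 1) - 1)
        = 1 - PowerSeries.X ^ (2 ^ (j + 1) - 1) := by
      ext n
      simp [CharTwo.sub_eq_add]
    rw [carlitzPiFactor, Nat.card_zmod, h2, map_sub, map_one, map_pow, ofPowerSeries_X, inv_pow,
      one_div]
  have h0 : mk (carlitzSeq (ZMod 2)) ≠ 0 := fun h =>
    transcendental_mk_carlitzSeq (ZMod 2) (h ▸ isAlgebraic_zero)
  rw [HasProd]
  simp_rw [hfac, Finset.prod_inv_distrib, ← map_prod]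
  refine Filter.Tendsto.inv₀ ?_ h0
  rw [← ofPowerSeries_mk]
  refine tendsto_ofPowerSeries fun D => ?_
  rw [SummationFilter.unconditional_filter]
  filter_upwards [Filter.eventually_ge_atTop (Finset.range D)] with s hs n hn
  rw [PowerSeries.coeff_mk, coeff_prod_one_add_X_pow _ hn hs]

end LaurentSeriesAtInfty

theorem corollary1 :
    (Multipliable (fun j : ℕ => carlitzPiFactor (ZMod 2) (j + 1)) ∧
      Transcendental (RatFunc (ZMod 2)) (carlitzPi (ZMod 2))) ∧
    ∀ (K : Type*) [Field K] [Finite K],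
      Transcendental (RatFunc K) (LaurentSeriesAtInfty.mk (carlitzSeq K)) := by
  have hprod := LaurentSeriesAtInfty.hasProd_carlitzPiFactor
  refine ⟨⟨hprod.multipliable, fun h => ?_⟩, fun K _ _ =>
    LaurentSeriesAtInfty.transcendental_mk_carlitzSeq K⟩
  rw [carlitzPi, hprod.tprod_eq] at h
  refine LaurentSeriesAtInfty.transcendental_mk_carlitzSeq (ZMod 2) ?_
  simpa using h.inv
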